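/- Let $n\ge 2$ and let $w\in\mathfrak S_n$ be a permutation with $\{w(1),\dots,w(r)\}\ne\{1,\dots,r\}$ for all $1\le r<n$. Let $X(w)$ be Elnitsky's polygon of $w$: the equilateral $2n$-gon whose sides are labeled $1,\dots,n,w(n),\dots,w(1)$ in counterclockwise order starting from the top vertex, such that the first $n$ sides (the leftside boundary) form half of a convex $2n$-gon and sides with the same label are parallel; the sides $w(1),\dots,w(n)$, read from the top vertex to the bottom vertex, form the rightside boundary. A rhombic tiling of $X(w)$ is a tiling by rhombi whose edges are congruent and parallel to sides of $X(w)$; the tile $\{x,y\}$ is the one whose edges are parallel to the sides labeled $x$ and $y$. A tile is a right- (left-) perimeter tile if it shares two consecutive edges with the rightside (leftside) boundary, and a top- (bottom-) perimeter tile if the two sides of $X(w)$ meeting in the top (bottom) vertex are edges of it. A tile is a forced right- (left-, top-, bottom-) perimeter tile for $w$ if it appears in every rhombic tiling of $X(w)$ as a right- (left-, top-, bottom-) perimeter tile. Then: 1. if there is a forced right-perimeter tile $\{w(1),w(2)\}$, then this tile is a forced top-perimeter tile, too; 2. if there is a forced left-perimeter tile $\{1,2\}$, then this tile is a forced top-perimeter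 tile, too; 3. if there is a forced right-perimeter tile $\{w(n-1),w(n)\}$, then this tile is a forced bottom-perimeter tile, too; 4. if there is a forced left-perimeter tile $\{n-1,n\}$, then this tile is a forced bottom-perimeter tile, too. -/

import Mathlib

open Set

noncomputable section

namespace Elnitsky

/-- Labels `1, …, n` are represented by `Fin n` (so the label `k` is the element `k - 1`).
A sequence of angles is admissible if the unit vectors with these angles, put end to end, form
half of a convex (equilateral) `2n`-gon, drawn as the leftside boundary from top to bottom,
traversed counterclockwise: the directions turn strictly counterclockwise and all point downwards. -/
def Admissible {n : ℕ} (θ : Fin n → ℝ) : Prop :=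
  StrictMono θ ∧ ∀ i, θ i ∈ Ioo Real.pi (2 * Real.pi)

/-- The (unit) edge vector of the sides labeled `i`, directed downwards. -/
def edgeVec {n : ℕ} (θ : Fin n → ℝ) (i : Fin n) : ℂ :=
  Complex.exp ((θ i : ℂ) * Complex.I)

/-- The `k`-th vertex (`k = 0, …, n`) of the path that starts in the top vertex `0` and whose
successive sides are labeled `u 0, u 1, …, u (n-1)` from top to bottom. -/
def vertex {n : ℕ} (θ : Fin n → ℝ) (u : Equiv.Perm (Fin n)) (k : ℕ) : ℂ :=
  ∑ i : Fin n with i.val < k, edgeVec θ (u i)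

/-- The side of this path that joins its `k`-th vertex to the next; its label is `u k`. -/
def pathSide {n : ℕ} (θ : Fin n → ℝ) (u : Equiv.Perm (Fin n)) (k : Fin n) : Set ℂ :=
  segment ℝ (vertex θ u k.val) (vertex θ u (k.val + 1))

/-- The `k`-th side from the top of the leftside boundary (label `k`). -/
def leftSide {n : ℕ} (θ : Fin n → ℝ) (k : Fin n) : Set ℂ := pathSide θ 1 k

/-- The `k`-th side from the top of the rightside boundary of `X(w)` (label `w k`). -/
def rightSide {n : ℕ} (θ : Fin n → ℝ) (w : Equiv.Perm (Fin n)) (k : Fin n) : Set ℂ :=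
  pathSide θ w k

def leftBoundary {n : ℕ} (θ : Fin n → ℝ) : Set ℂ := ⋃ k, leftSide θ k

def rightBoundary {n : ℕ} (θ : Fin n → ℝ) (w : Equiv.Perm (Fin n)) : Set ℂ :=
  ⋃ k, rightSide θ w k

/-- Elnitsky's polygon `X(w)` as a closed region of the plane. All sides are directed strictly
downwards, so each boundary path meets each horizontal line between top and bottom in one point;
the region consists of the horizontal segments from the leftside to the rightside boundary. -/
def polygon {n : ℕ} (θ : Fin n → ℝ) (w : Equiv.Perm (Fin n)) : Set ℂ :=
  {p | ∃ l ∈ leftBoundary θ, ∃ r ∈ rightBoundary θ w,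
    l.im = p.im ∧ r.im = p.im ∧ l.re ≤ p.re ∧ p.re ≤ r.re}

/-- A rhombic tile whose edges are congruent and parallel to sides of the polygon: it is given by
its top vertex and its two labels. -/
structure Tile (n : ℕ) where
  top : ℂ
  lo : Fin n
  hi : Fin n
  lo_lt_hi : lo < hi

namespace Tile

variable {n : ℕ}

/-- The set of the two labels of a tile. -/
def labels (t : Tile n) : Finset (Fin n) := {t.lo, t.hi}

/-- The closed rhombus that the tile occupies. -/
def carrier (θ : Fin n → ℝ) (t : Tile n) : Set ℂ :=
  {z | ∃ a ∈ Icc (0 : ℝ) 1, ∃ b ∈ Icc (0 : ℝ) 1,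
    z = t.top + (a : ℂ) * edgeVec θ t.lo + (b : ℂ) * edgeVec θ t.hi}

/-- The four edges of the tile. -/
def edges (θ : Fin n → ℝ) (t : Tile n) : Set (Set ℂ) :=
  {segment ℝ t.top (t.top + edgeVec θ t.lo),
   segment ℝ t.top (t.top + edgeVec θ t.hi),
   segment ℝ (t.top + edgeVec θ t.lo) (t.top + edgeVec θ t.lo + edgeVec θ t.hi),
   segment ℝ (t.top + edgeVec θ t.hi) (t.top + edgeVec θ t.lo + edgeVec θ t.hi)}

end Tile

/-- `T` is a rhombic tiling of `X(w)`: its tiles cover exactly the polygon, and distinct tiles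
have disjoint interiors. -/
def IsRhombicTiling {n : ℕ} (θ : Fin n → ℝ) (w : Equiv.Perm (Fin n)) (T : Finset (Tile n)) :
    Prop :=
  (⋃ t ∈ T, t.carrier θ) = polygon θ w ∧
    (T : Set (Tile n)).Pairwise fun s t =>
      Disjoint (interior (s.carrier θ)) (interior (t.carrier θ))

/-- The tile shares two consecutive edges with the leftside boundary. -/
def IsLeftPerimeter {n : ℕ} (θ : Fin n → ℝ) (t : Tile n) : Prop :=
  ∃ j k : Fin n, k.val = j.val + 1 ∧ leftSide θ j ∈ t.edges θ ∧ leftSide θ k ∈ t.edges θ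

/-- The tile shares two consecutive edges with the rightside boundary. -/
def IsRightPerimeter {n : ℕ} (θ : Fin n → ℝ) (w : Equiv.Perm (Fin n)) (t : Tile n) : Prop :=
  ∃ j k : Fin n, k.val = j.val + 1 ∧ rightSide θ w j ∈ t.edges θ ∧ rightSide θ w k ∈ t.edges θ

/-- The tile has as edges the two sides of `X(w)` that meet in the top vertex. -/
def IsTopPerimeter {n : ℕ} (θ : Fin n → ℝ) (w : Equiv.Perm (Fin n)) (t : Tile n) : Prop :=
  ∃ k : Fin n, k.val = 0 ∧ leftSide θ k ∈ t.edges θ ∧ rightSide θ w k ∈ t.edges θ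

/-- The tile has as edges the two sides of `X(w)` that meet in the bottom vertex. -/
def IsBottomPerimeter {n : ℕ} (θ : Fin n → ℝ) (w : Equiv.Perm (Fin n)) (t : Tile n) : Prop :=
  ∃ k : Fin n, k.val + 1 = n ∧ leftSide θ k ∈ t.edges θ ∧ rightSide θ w k ∈ t.edges θ

/-- The tile `t` appears in all rhombic tilings of `X(w)` as a left-perimeter tile. -/
def IsForcedLeft {n : ℕ} (θ : Fin n → ℝ) (w : Equiv.Perm (Fin n)) (t : Tile n) : Prop :=
  ∀ T, IsRhombicTiling θ w T → t ∈ T ∧ IsLeftPerimeter θ t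

/-- The tile `t` appears in all rhombic tilings of `X(w)` as a right-perimeter tile. -/
def IsForcedRight {n : ℕ} (θ : Fin n → ℝ) (w : Equiv.Perm (Fin n)) (t : Tile n) : Prop :=
  ∀ T, IsRhombicTiling θ w T → t ∈ T ∧ IsRightPerimeter θ w t

/-- The tile `t` appears in all rhombic tilings of `X(w)` as a top-perimeter tile. -/
def IsForcedTop {n : ℕ} (θ : Fin n → ℝ) (w : Equiv.Perm (Fin n)) (t : Tile n) : Prop :=
  ∀ T, IsRhombicTiling θ w T → t ∈ T ∧ IsTopPerimeter θ w t

/-- The tile `t` appears in all rhombic tilings of `X(w)` as a bottom-perimeter tile. -/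
def IsForcedBottom {n : ℕ} (θ : Fin n → ℝ) (w : Equiv.Perm (Fin n)) (t : Tile n) : Prop :=
  ∀ T, IsRhombicTiling θ w T → t ∈ T ∧ IsBottomPerimeter θ w t

/-- `{w(1), …, w(r)} ≠ {1, …, r}` for all `0 < r < n`. -/
def FullySupported {n : ℕ} (w : Equiv.Perm (Fin n)) : Prop :=
  ∀ r : ℕ, 0 < r → r < n → w '' {i | i.val < r} ≠ {i | i.val < r}

end Elnitsky

end

/-! A single well-chosen tiling suffices. A forced tile with labels w(1), w(2) (or 1, 2) has the
first side of the right (or left) boundary as an edge, so it contains the top vertex. On the other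
hand, some tiling contains the tile {1, w(1)} spanned by the first sides of both boundaries. This
tile fills the angle of the polygon at the top vertex, so a second tile of that tiling containing
the vertex would overlap its interior (`IsRhombicTiling.eq_top_tile`). Hence the forced tile is {1,
w(1)}; it lies in every tiling and has both top sides as edges (`isForcedTop_of_zero_mem`). The
bottom vertex is treated in the same way with the labels n and w(n).

The special tiling comes from sorting w by adjacent transpositions: undoing a descent peels one
rhombus off the right boundary (`IsPartialTiling.insert_swapTile`), and any order of sorting is
allowed. Bringing the label 1 to the front before anything else makes {1, w(1)} the last rhombus of
this first phase (`exists_isPartialTiling_top`). Full support makes w(1) differ from 1 and w(n) from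
n, and ensures that the tiles also cover the left boundary. -/

namespace Elnitsky

/-! ### Plane geometry of a rhombus with downward edges. -/

section Rhombus

theorem mem_segment_add {p a z : ℂ} :
    z ∈ segment ℝ p (p + a) ↔ ∃ s ∈ Icc (0 : ℝ) 1, z = p + (s : ℂ) * a := by
  rw [segment_eq_image']
  simp [eq_comm]

/-- The closed parallelogram with top vertex `p` spanned by `a` and `b`. -/
def rhombus (p a b : ℂ) : Set ℂ :=
  {z | ∃ s ∈ Icc (0 : ℝ) 1, ∃ t ∈ Icc (0 : ℝ) 1, z = p + (s : ℂ) * a + (t : ℂ) * b}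

/-- The determinant of two plane vectors. -/
def cross (a b : ℂ) : ℝ := a.re * b.im - a.im * b.re

variable {p a b z : ℂ}

theorem rhombus_comm (p a b : ℂ) : rhombus p a b = rhombus p b a := by
  ext z
  constructor <;> rintro ⟨s, hs, t, ht, rfl⟩ <;> exact ⟨t, ht, s, hs, by ring⟩

theorem segment_subset_rhombus_fst : segment ℝ p (p + a) ⊆ rhombus p a b := by
  intro z hz
  obtain ⟨s, hs, rfl⟩ := mem_segment_add.1 hz
  exact ⟨s, hs, 0, by simp, by simp⟩

theorem segment_subset_rhombus_fst_snd : segment ℝ (p + a) (p + a + b) ⊆ rhombus p a b := by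
  intro z hz
  obtain ⟨s, hs, rfl⟩ := mem_segment_add.1 hz
  exact ⟨1, by simp, s, hs, by simp⟩

theorem segment_subset_rhombus_snd : segment ℝ p (p + b) ⊆ rhombus p a b :=
  rhombus_comm p a b ▸ segment_subset_rhombus_fst

theorem segment_subset_rhombus_snd_fst : segment ℝ (p + b) (p + a + b) ⊆ rhombus p a b := by
  rw [rhombus_comm, add_right_comm]
  exact segment_subset_rhombus_fst_snd

theorem convex_rhombus (p a b : ℂ) : Convex ℝ (rhombus p a b) := by
  rintro _ ⟨s, hs, t, ht, rfl⟩ _ ⟨s', hs', t', ht', rfl⟩ x y hx hy hxy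
  refine ⟨x * s + y * s', convex_Icc (0 : ℝ) 1 hs hs' hx hy hxy,
    x * t + y * t', convex_Icc (0 : ℝ) 1 ht ht' hx hy hxy, ?_⟩
  have : (y : ℂ) = 1 - x := by rw [eq_sub_iff_add_eq', ← Complex.ofReal_add, hxy, Complex.ofReal_one]
  simp only [Complex.real_smul]
  push_cast
  rw [this]
  ring

theorem mem_of_convex_of_re {S : Set ℂ} (hS : Convex ℝ S) {l r z : ℂ} (hl : l ∈ S) (hr : r ∈ S)
    (hli : l.im = z.im) (hri : r.im = z.im) (hlz : l.re ≤ z.re) (hzr : z.re ≤ r.re) : z ∈ S := by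
  have hz : z.re ∈ segment ℝ l.re r.re := by
    rw [segment_eq_Icc (hlz.trans hzr)]
    exact ⟨hlz, hzr⟩
  obtain ⟨x, y, hx, hy, hxy, h⟩ := hz
  have : z = x • l + y • r := by
    apply Complex.ext
    · simpa using h.symm
    · simp [hli, hri, ← add_mul, hxy]
  rw [this]
  exact hS hl hr hx hy hxy

/-- A positive determinant of two downward vectors puts `a` to the left of `b`, so moving
horizontally to the left ends on the side `a` followed by `b`. The two cases are heights below and
above the corner `p + a`. -/
theorem exists_left_of_mem_rhombus (ha : a.im < 0) (hb : b.im < 0) (hab : 0 < cross a b)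
    (hz : z ∈ rhombus p a b) :
    ∃ l ∈ segment ℝ p (p + a) ∪ segment ℝ (p + a) (p + a + b), l.im = z.im ∧ l.re ≤ z.re := by
  obtain ⟨s, ⟨hs0, hs1⟩, t, ⟨ht0, ht1⟩, rfl⟩ := hz
  unfold cross at hab
  have ha0 := ha.ne
  have hb0 := hb.ne
  rcases le_total ((1 - s) * -a.im) (t * -b.im) with h | h
  · refine ⟨p + a + ((t - (1 - s) * a.im / b.im : ℝ) : ℂ) * b, Or.inr (mem_segment_add.2
      ⟨_, ⟨?_, ?_⟩, rfl⟩), ?_, ?_⟩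
    · rw [sub_nonneg, div_le_iff_of_neg hb]; linarith
    · have : 0 ≤ (1 - s) * a.im / b.im := div_nonneg_of_nonpos (by nlinarith) hb.le
      linarith
    · simp; field_simp; ring
    · have : 0 ≤ (1 - s) * (a.re * b.im - a.im * b.re) / -b.im :=
        div_nonneg (mul_nonneg (by linarith) hab.le) (by linarith)
      have e : (1 - s) * (a.re * b.im - a.im * b.re) / -b.im
        = (1 - s) * a.im / b.im * b.re - (1 - s) * a.re := by
        field_simp; ring
      simp only [Complex.add_re, Complex.re_ofReal_mul]
      nlinarith
  · refine ⟨p + ((s + t * b.im / a.im : ℝ) : ℂ) * a, Or.inl (mem_segment_add.2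
      ⟨_, ⟨?_, ?_⟩, rfl⟩), ?_, ?_⟩
    · have : 0 ≤ t * b.im / a.im := div_nonneg_of_nonpos (by nlinarith) ha.le
      linarith
    · have : t * b.im / a.im ≤ 1 - s := by rw [div_le_iff_of_neg ha]; linarith
      linarith
    · simp; field_simp; ring
    · have : 0 ≤ t * (a.re * b.im - a.im * b.re) / -a.im :=
        div_nonneg (mul_nonneg (by linarith) hab.le) (by linarith)
      have e : t * (a.re * b.im - a.im * b.re) / -a.im
        = t * b.re - t * b.im / a.im * a.re := by
        field_simp; ring
      simp only [Complex.add_re, Complex.re_ofReal_mul]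
      nlinarith

theorem exists_right_of_mem_rhombus (ha : a.im < 0) (hb : b.im < 0) (hab : 0 < cross a b)
    (hz : z ∈ rhombus p a b) :
    ∃ r ∈ segment ℝ p (p + b) ∪ segment ℝ (p + b) (p + a + b), r.im = z.im ∧ z.re ≤ r.re := by
  obtain ⟨s, ⟨hs0, hs1⟩, t, ⟨ht0, ht1⟩, rfl⟩ := hz
  unfold cross at hab
  have ha0 := ha.ne
  have hb0 := hb.ne
  rcases le_total ((1 - t) * -b.im) (s * -a.im) with h | h
  · refine ⟨p + b + ((s - (1 - t) * b.im / a.im : ℝ) : ℂ) * a, Or.inr ?_, ?_, ?_⟩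
    · rw [add_right_comm p a b]
      refine mem_segment_add.2 ⟨_, ⟨?_, ?_⟩, rfl⟩
      · rw [sub_nonneg, div_le_iff_of_neg ha]; linarith
      · have : 0 ≤ (1 - t) * b.im / a.im := div_nonneg_of_nonpos (by nlinarith) ha.le
        linarith
    · simp; field_simp; ring
    · have : 0 ≤ (1 - t) * (a.re * b.im - a.im * b.re) / -a.im :=
        div_nonneg (mul_nonneg (by linarith) hab.le) (by linarith)
      have e : (1 - t) * (a.re * b.im - a.im * b.re) / -a.im
        = (1 - t) * b.re - (1 - t) * b.im / a.im * a.re := by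
        field_simp; ring
      simp only [Complex.add_re, Complex.re_ofReal_mul]
      nlinarith
  · refine ⟨p + ((t + s * a.im / b.im : ℝ) : ℂ) * b, Or.inl (mem_segment_add.2
      ⟨_, ⟨?_, ?_⟩, rfl⟩), ?_, ?_⟩
    · have : 0 ≤ s * a.im / b.im := div_nonneg_of_nonpos (by nlinarith) hb.le
      linarith
    · have : s * a.im / b.im ≤ 1 - t := by rw [div_le_iff_of_neg hb]; linarith
      linarith
    · simp; field_simp; ring
    · have : 0 ≤ s * (a.re * b.im - a.im * b.re) / -b.im :=
        div_nonneg (mul_nonneg (by linarith) hab.le) (by linarith)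
      have e : s * (a.re * b.im - a.im * b.re) / -b.im
        = s * a.im / b.im * b.re - s * a.re := by
        field_simp; ring
      simp only [Complex.add_re, Complex.re_ofReal_mul]
      nlinarith

/-- Cramer's rule. -/
theorem eq_combination_of_cross_ne_zero (hab : cross a b ≠ 0) (z : ℂ) :
    z = ((cross z b / cross a b : ℝ) : ℂ) * a + ((cross a z / cross a b : ℝ) : ℂ) * b := by
  have h : cross a b = a.re * b.im - a.im * b.re := rfl
  apply Complex.ext
  · simp only [Complex.add_re, Complex.re_ofReal_mul]
    field_simp
    simp only [cross]
    ring
  · simp only [Complex.add_im, Complex.im_ofReal_mul]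
    field_simp
    simp only [cross]
    ring

theorem continuous_cross_left (b : ℂ) : Continuous fun z => cross z b := by
  unfold cross; fun_prop

theorem continuous_cross_right (a : ℂ) : Continuous fun z => cross a z := by
  unfold cross; fun_prop

theorem mem_interior_rhombus (hab : cross a b ≠ 0) {s t : ℝ} (hs : s ∈ Ioo (0 : ℝ) 1)
    (ht : t ∈ Ioo (0 : ℝ) 1) : p + (s : ℂ) * a + (t : ℂ) * b ∈ interior (rhombus p a b) := by
  have hf : Continuous fun z => cross (z - p) b / cross a b :=
    ((continuous_cross_left b).comp (continuous_id.sub continuous_const)).div_const _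
  have hg : Continuous fun z => cross a (z - p) / cross a b :=
    ((continuous_cross_right a).comp (continuous_id.sub continuous_const)).div_const _
  refine mem_interior.2 ⟨_, ?_, (isOpen_Ioo.preimage hf).inter (isOpen_Ioo.preimage hg),
    (?_ : _ ∈ Ioo (0 : ℝ) 1), (?_ : _ ∈ Ioo (0 : ℝ) 1)⟩
  · rintro z ⟨hz, hz'⟩
    refine ⟨_, Ioo_subset_Icc_self hz, _, Ioo_subset_Icc_self hz', ?_⟩
    rw [add_assoc, ← eq_combination_of_cross_ne_zero hab, add_sub_cancel]
  · convert hs using 1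
    rw [div_eq_iff hab]
    simp [cross]; ring
  · convert ht using 1
    rw [div_eq_iff hab]
    simp [cross]; ring

end Rhombus

/-- A common interior point could be moved slightly to the right inside `S`, beyond its own original
position in `R`. -/
theorem disjoint_interior_of_re_le {S R : Set ℂ}
    (h : ∀ z ∈ S, ∀ z' ∈ R, z.im = z'.im → z.re ≤ z'.re) :
    Disjoint (interior S) (interior R) := by
  rw [Set.disjoint_left]
  intro z hS hR
  have hc : Continuous fun ε : ℝ => z + ε := by fun_prop
  have h0 : ∀ᶠ ε : ℝ in nhds 0, z + (ε : ℂ) ∈ interior S :=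
    hc.continuousAt.eventually_mem (by simpa using isOpen_interior.mem_nhds hS)
  obtain ⟨ε, hε, hε0⟩ := ((h0.filter_mono nhdsWithin_le_nhds).and
    (self_mem_nhdsWithin : Ioi (0 : ℝ) ∈ nhdsWithin 0 (Ioi 0))).exists
  have := h _ (interior_subset hε) _ (interior_subset hR) (by simp)
  simp only [Complex.add_re, Complex.ofReal_re] at this
  have : 0 < ε := hε0
  linarith

/-! ### The order of labels as the sign of a determinant. -/

section Edges

variable {n : ℕ} {θ : Fin n → ℝ}

theorem edgeVec_im_neg (hθ : Admissible θ) (i : Fin n) : (edgeVec θ i).im < 0 := by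
  rw [edgeVec, Complex.exp_ofReal_mul_I_im]
  have h := hθ.2 i
  have : 0 < Real.sin (θ i - Real.pi) :=
    Real.sin_pos_of_pos_of_lt_pi (by linarith [h.1]) (by linarith [h.2])
  rw [Real.sin_sub_pi] at this
  linarith

theorem cross_edgeVec_pos (hθ : Admissible θ) {i j : Fin n} (hij : i < j) :
    0 < cross (edgeVec θ i) (edgeVec θ j) := by
  have : 0 < Real.sin (θ j - θ i) :=
    Real.sin_pos_of_pos_of_lt_pi (by linarith [hθ.1 hij]) (by linarith [(hθ.2 i).1, (hθ.2 j).2])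
  rw [Real.sin_sub] at this
  simp only [cross, edgeVec, Complex.exp_ofReal_mul_I_im, Complex.exp_ofReal_mul_I_re]
  linarith

theorem cross_edgeVec_nonneg (hθ : Admissible θ) {i j : Fin n} (hij : i ≤ j) :
    0 ≤ cross (edgeVec θ i) (edgeVec θ j) := by
  rcases hij.eq_or_lt with rfl | h
  · simp [cross, mul_comm]
  · exact (cross_edgeVec_pos hθ h).le

theorem le_of_cross_edgeVec_nonneg (hθ : Admissible θ) {i j : Fin n}
    (h : 0 ≤ cross (edgeVec θ i) (edgeVec θ j)) : i ≤ j := by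
  by_contra! hji
  have := cross_edgeVec_pos hθ hji
  simp only [cross] at h this
  linarith

theorem edgeVec_injective (hθ : Admissible θ) : Function.Injective (edgeVec θ) := by
  intro i j h
  have h0 : cross (edgeVec θ i) (edgeVec θ j) = 0 := by simp [h, cross, mul_comm]
  have h1 : cross (edgeVec θ j) (edgeVec θ i) = 0 := by simp [h, cross, mul_comm]
  exact le_antisymm (le_of_cross_edgeVec_nonneg hθ h0.ge) (le_of_cross_edgeVec_nonneg hθ h1.ge)

end Edges

/-! ### Descending paths from the top vertex. -/

section Paths

variable {n : ℕ} {θ : Fin n → ℝ} {u : Equiv.Perm (Fin n)}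

/-- The path from the top vertex with the side labels `u 0, u 1, …`. -/
def path (θ : Fin n → ℝ) (u : Equiv.Perm (Fin n)) : Set ℂ := ⋃ k, pathSide θ u k

theorem vertex_zero (θ : Fin n → ℝ) (u : Equiv.Perm (Fin n)) : vertex θ u 0 = 0 := by
  simp [vertex]

theorem vertex_succ (θ : Fin n → ℝ) (u : Equiv.Perm (Fin n)) (k : Fin n) :
    vertex θ u (k.val + 1) = vertex θ u k.val + edgeVec θ (u k) := by
  have : (Finset.univ.filter fun i : Fin n => i.val < k.val + 1)
      = insert k (Finset.univ.filter fun i : Fin n => i.val < k.val) := by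
    ext i
    simp [Fin.ext_iff]
    omega
  rw [vertex, this, Finset.sum_insert (by simp), add_comm, vertex]

theorem vertex_eq_sum (θ : Fin n → ℝ) (u : Equiv.Perm (Fin n)) :
    vertex θ u n = ∑ i, edgeVec θ i := by
  simp [vertex, Equiv.sum_comp u (edgeVec θ)]

theorem vertex_mul_of_forall (σ : Equiv.Perm (Fin n)) {m : ℕ}
    (h : ∀ i, (σ i).val < m ↔ i.val < m) : vertex θ (u * σ) m = vertex θ u m :=
  Finset.sum_equiv σ (by simp [h]) (by simp)

theorem vertex_im_antitone (hθ : Admissible θ) {l m : ℕ} (h : l ≤ m) :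
    (vertex θ u m).im ≤ (vertex θ u l).im := by
  rw [vertex, vertex, Complex.im_sum, Complex.im_sum, ← neg_le_neg_iff, ← Finset.sum_neg_distrib,
    ← Finset.sum_neg_distrib]
  refine Finset.sum_le_sum_of_subset_of_nonneg
    (Finset.monotone_filter_right _ fun i _ hi => lt_of_lt_of_le hi h)
    fun i _ _ => neg_nonneg.2 (edgeVec_im_neg hθ _).le

theorem mem_pathSide {k : Fin n} {z : ℂ} : z ∈ pathSide θ u k ↔
    ∃ s ∈ Icc (0 : ℝ) 1, z = vertex θ u k.val + (s : ℂ) * edgeVec θ (u k) := by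
  rw [pathSide, vertex_succ, mem_segment_add]

theorem mem_path {z : ℂ} : z ∈ path θ u ↔ ∃ k, z ∈ pathSide θ u k := mem_iUnion

theorem im_le_of_mem_pathSide (hθ : Admissible θ) {k : Fin n} {z : ℂ} (hz : z ∈ pathSide θ u k) :
    z.im ≤ (vertex θ u k.val).im := by
  obtain ⟨s, hs, rfl⟩ := mem_pathSide.1 hz
  have := mul_nonpos_of_nonneg_of_nonpos hs.1 (edgeVec_im_neg hθ (u k)).le
  simpa using this

theorem le_im_of_mem_pathSide (hθ : Admissible θ) {k : Fin n} {z : ℂ} (hz : z ∈ pathSide θ u k) :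
    (vertex θ u (k.val + 1)).im ≤ z.im := by
  obtain ⟨s, hs, rfl⟩ := mem_pathSide.1 hz
  have := mul_nonpos_of_nonneg_of_nonpos (sub_nonneg.2 hs.2) (edgeVec_im_neg hθ (u k)).le
  simp only [vertex_succ, Complex.add_im, Complex.im_ofReal_mul]
  linarith

theorem eq_of_mem_pathSide (hθ : Admissible θ) {k : Fin n} {z z' : ℂ} (hz : z ∈ pathSide θ u k)
    (hz' : z' ∈ pathSide θ u k) (h : z.im = z'.im) : z = z' := by
  obtain ⟨s, -, rfl⟩ := mem_pathSide.1 hz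
  obtain ⟨s', -, rfl⟩ := mem_pathSide.1 hz'
  simp only [Complex.add_im, Complex.im_ofReal_mul, add_right_inj] at h
  rw [mul_right_cancel₀ (edgeVec_im_neg hθ _).ne h]

theorem left_mem_pathSide (k : Fin n) : vertex θ u k.val ∈ pathSide θ u k := left_mem_segment ..

theorem right_mem_pathSide (k : Fin n) : vertex θ u (k.val + 1) ∈ pathSide θ u k :=
  right_mem_segment ..

theorem vertex_im_succ_lt (hθ : Admissible θ) (k : Fin n) :
    (vertex θ u (k.val + 1)).im < (vertex θ u k.val).im := by
  have := edgeVec_im_neg hθ (u k)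
  simpa [vertex_succ] using this

/-- A path meets each horizontal line at most once. -/
theorem eq_of_mem_path (hθ : Admissible θ) {z z' : ℂ} (hz : z ∈ path θ u) (hz' : z' ∈ path θ u)
    (h : z.im = z'.im) : z = z' := by
  obtain ⟨k, hk⟩ := mem_path.1 hz
  obtain ⟨l, hl⟩ := mem_path.1 hz'
  wlog hkl : k ≤ l generalizing z z' k l
  · exact (this hz' hz h.symm l hl k hk (le_of_not_ge hkl)).symm
  rcases hkl.eq_or_lt with rfl | hkl
  · exact eq_of_mem_pathSide hθ hk hl h
  have h1 := im_le_of_mem_pathSide hθ hl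
  have h2 := le_im_of_mem_pathSide hθ hk
  have h3 := vertex_im_antitone (u := u) hθ (Nat.succ_le_of_lt (Fin.lt_def.1 hkl))
  -- Heights drop strictly along a path, so two different sides at a common height must be adjacent
  -- and meet there in their shared vertex.
  have h4 : l.val = k.val + 1 := by
    by_contra hne
    have h5 := vertex_im_antitone (u := u) hθ (show k.val + 1 + 1 ≤ l.val by
      have := Fin.lt_def.1 hkl; omega)
    have h6 := vertex_im_succ_lt (u := u) hθ ⟨k.val + 1, by have := l.isLt; omega⟩
    simp only at h6
    linarith
  have h7 := left_mem_pathSide (θ := θ) (u := u) l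
  rw [eq_of_mem_pathSide hθ hl h7 (by rw [h4] at h1 ⊢; simp only [Nat.succ_eq_add_one] at h3; linarith), h4]
  exact eq_of_mem_pathSide hθ hk (right_mem_pathSide k) (by rw [h4] at h1; linarith)

theorem mem_polygon {w : Equiv.Perm (Fin n)} {z : ℂ} : z ∈ polygon θ w ↔
    ∃ l ∈ path θ 1, ∃ r ∈ path θ w, l.im = z.im ∧ r.im = z.im ∧ l.re ≤ z.re ∧ z.re ≤ r.re :=
  Iff.rfl

end Paths

/-! ### Exchanging two adjacent labels of a path. -/

section AdjacentSwap

variable {n : ℕ} {θ : Fin n → ℝ} {u : Equiv.Perm (Fin n)} {j k : Fin n}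

/-- Among initial segments of positions, only the one ending between `j` and `k` is changed. Hence
the swap moves a single vertex of the path. -/
theorem swap_val_lt_iff (hjk : k.val = j.val + 1) {m : ℕ} (hm : m ≠ j.val + 1) (i : Fin n) :
    (Equiv.swap j k i).val < m ↔ i.val < m := by
  rw [Equiv.swap_apply_def]
  split_ifs with h1 h2
  · subst h1; omega
  · subst h2; omega
  · rfl

theorem vertex_mul_swap (hjk : k.val = j.val + 1) {m : ℕ} (hm : m ≠ j.val + 1) :
    vertex θ (u * Equiv.swap j k) m = vertex θ u m :=
  vertex_mul_of_forall _ (swap_val_lt_iff hjk hm)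

theorem pathSide_mul_swap (hjk : k.val = j.val + 1) {i : Fin n} (hj : i ≠ j) (hk : i ≠ k) :
    pathSide θ (u * Equiv.swap j k) i = pathSide θ u i := by
  have := Fin.val_ne_of_ne hj
  have := Fin.val_ne_of_ne hk
  rw [pathSide, pathSide, vertex_mul_swap hjk (by omega), vertex_mul_swap hjk (by omega)]

theorem pathSide_upper (u : Equiv.Perm (Fin n)) (j : Fin n) : pathSide θ u j =
    segment ℝ (vertex θ u j.val) (vertex θ u j.val + edgeVec θ (u j)) := by
  rw [pathSide, vertex_succ]

theorem pathSide_lower (u : Equiv.Perm (Fin n)) (hjk : k.val = j.val + 1) : pathSide θ u k =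
    segment ℝ (vertex θ u j.val + edgeVec θ (u j))
      (vertex θ u j.val + edgeVec θ (u j) + edgeVec θ (u k)) := by
  rw [pathSide, vertex_succ, hjk, vertex_succ]

theorem pathSide_mul_swap_upper (u : Equiv.Perm (Fin n)) (hjk : k.val = j.val + 1) :
    pathSide θ (u * Equiv.swap j k) j =
      segment ℝ (vertex θ u j.val) (vertex θ u j.val + edgeVec θ (u k)) := by
  rw [pathSide_upper, vertex_mul_swap hjk (by omega)]
  simp

theorem pathSide_mul_swap_lower (u : Equiv.Perm (Fin n)) (hjk : k.val = j.val + 1) :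
    pathSide θ (u * Equiv.swap j k) k = segment ℝ (vertex θ u j.val + edgeVec θ (u k))
      (vertex θ u j.val + edgeVec θ (u j) + edgeVec θ (u k)) := by
  rw [pathSide_lower _ hjk, vertex_mul_swap hjk (by omega), add_right_comm]
  simp

/-- The rhombus between the path of `u` and the path obtained by exchanging two adjacent labels. -/
noncomputable def swapTile (θ : Fin n → ℝ) (u : Equiv.Perm (Fin n)) (j k : Fin n) (h : u j < u k) : Tile n :=
  ⟨vertex θ u j.val, u j, u k, h⟩

theorem exists_path_left_of_mem_swapTile (hθ : Admissible θ) (hjk : k.val = j.val + 1)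
    (h : u j < u k) {z : ℂ} (hz : z ∈ (swapTile θ u j k h).carrier θ) :
    ∃ l ∈ path θ u, l.im = z.im ∧ l.re ≤ z.re := by
  obtain ⟨l, hl, hl'⟩ := exists_left_of_mem_rhombus (edgeVec_im_neg hθ (u j))
    (edgeVec_im_neg hθ (u k)) (cross_edgeVec_pos hθ h) hz
  refine ⟨l, mem_path.2 (hl.elim (fun hl => ⟨j, ?_⟩) fun hl => ⟨k, ?_⟩), hl'⟩
  · rwa [pathSide_upper]
  · rwa [pathSide_lower _ hjk]

theorem exists_path_right_of_mem_swapTile (hθ : Admissible θ) (hjk : k.val = j.val + 1)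
    (h : u j < u k) {z : ℂ} (hz : z ∈ (swapTile θ u j k h).carrier θ) :
    ∃ r ∈ path θ (u * Equiv.swap j k), r.im = z.im ∧ z.re ≤ r.re := by
  obtain ⟨l, hl, hl'⟩ := exists_right_of_mem_rhombus (edgeVec_im_neg hθ (u j))
    (edgeVec_im_neg hθ (u k)) (cross_edgeVec_pos hθ h) hz
  refine ⟨l, mem_path.2 (hl.elim (fun hl => ⟨j, ?_⟩) fun hl => ⟨k, ?_⟩), hl'⟩
  · rwa [pathSide_mul_swap_upper _ hjk]
  · rwa [pathSide_mul_swap_lower _ hjk]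

theorem mem_path_mul_swap_or (hjk : k.val = j.val + 1) (h : u j < u k) {z : ℂ}
    (hz : z ∈ path θ u) :
    z ∈ path θ (u * Equiv.swap j k) ∨ z ∈ (swapTile θ u j k h).carrier θ := by
  obtain ⟨i, hi⟩ := mem_path.1 hz
  by_cases hij : i = j
  · subst hij
    rw [pathSide_upper] at hi
    exact Or.inr (segment_subset_rhombus_fst hi)
  by_cases hik : i = k
  · subst hik
    rw [pathSide_lower _ hjk] at hi
    exact Or.inr (segment_subset_rhombus_fst_snd hi)
  exact Or.inl (mem_path.2 ⟨i, by rwa [pathSide_mul_swap hjk hij hik]⟩)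

theorem mem_path_or_of_mul_swap (hjk : k.val = j.val + 1) (h : u j < u k) {z : ℂ}
    (hz : z ∈ path θ (u * Equiv.swap j k)) :
    z ∈ path θ u ∨ z ∈ (swapTile θ u j k h).carrier θ := by
  obtain ⟨i, hi⟩ := mem_path.1 hz
  by_cases hij : i = j
  · subst hij
    rw [pathSide_mul_swap_upper _ hjk] at hi
    exact Or.inr (segment_subset_rhombus_snd hi)
  by_cases hik : i = k
  · subst hik
    rw [pathSide_mul_swap_lower _ hjk] at hi
    exact Or.inr (segment_subset_rhombus_snd_fst hi)
  exact Or.inl (mem_path.2 ⟨i, by rwa [← pathSide_mul_swap hjk hij hik]⟩)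

theorem exists_path_left_of_mem_path_mul_swap (hθ : Admissible θ) (hjk : k.val = j.val + 1)
    (h : u j < u k) {z : ℂ} (hz : z ∈ path θ (u * Equiv.swap j k)) :
    ∃ l ∈ path θ u, l.im = z.im ∧ l.re ≤ z.re :=
  (mem_path_or_of_mul_swap hjk h hz).elim (fun hz => ⟨z, hz, rfl, le_rfl⟩)
    (exists_path_left_of_mem_swapTile hθ hjk h)

theorem polygon_mul_swap (hθ : Admissible θ) (hjk : k.val = j.val + 1) (h : u j < u k)
    (hu : ∀ r ∈ path θ u, ∃ l ∈ path θ 1, l.im = r.im ∧ l.re ≤ r.re) :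
    polygon θ (u * Equiv.swap j k) = polygon θ u ∪ (swapTile θ u j k h).carrier θ := by
  ext z
  rw [mem_union, mem_polygon, mem_polygon]
  constructor
  · rintro ⟨l, hl, r, hr, hlz, hrz, hl', hr'⟩
    rcases mem_path_or_of_mul_swap hjk h hr with hr | hr
    · exact Or.inl ⟨l, hl, r, hr, hlz, hrz, hl', hr'⟩
    -- Cut the horizontal line at the point `m` of the old path: left of it is the old polygon, and
    -- right of it, up to `r`, is the rhombus. If `m` also lies on the new path, it coincides with
    -- `r`.
    obtain ⟨m, hm, hmr, -⟩ := exists_path_left_of_mem_swapTile hθ hjk h hr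
    by_cases hmz : z.re ≤ m.re
    · exact Or.inl ⟨l, hl, m, hm, hlz, hmr.trans hrz, hl', hmz⟩
    rcases mem_path_mul_swap_or hjk h hm with hm | hm
    · rw [eq_of_mem_path hθ hm ‹r ∈ path θ _› hmr] at hmz
      exact absurd hr' hmz
    · exact Or.inr (mem_of_convex_of_re (convex_rhombus _ _ _) hm hr (hmr.trans hrz) hrz
        (le_of_not_ge hmz) hr')
  · rintro (⟨l, hl, r, hr, hlz, hrz, hl', hr'⟩ | hz)
    · rcases mem_path_mul_swap_or hjk h hr with hr | hr
      · exact ⟨l, hl, r, hr, hlz, hrz, hl', hr'⟩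
      · obtain ⟨m, hm, hmr, hrm⟩ := exists_path_right_of_mem_swapTile hθ hjk h hr
        exact ⟨l, hl, m, hm, hlz, hmr.trans hrz, hl', hr'.trans hrm⟩
    · obtain ⟨m, hm, hmz, hmz'⟩ := exists_path_left_of_mem_swapTile hθ hjk h hz
      obtain ⟨r, hr, hrz, hrz'⟩ := exists_path_right_of_mem_swapTile hθ hjk h hz
      obtain ⟨l, hl, hlm, hlm'⟩ := hu m hm
      exact ⟨l, hl, r, hr, hlm.trans hmz, hrz, hlm'.trans hmz', hrz'⟩

/-- The path of `u` separates the two regions on every horizontal line. -/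
theorem disjoint_interior_polygon_swapTile (hθ : Admissible θ) (hjk : k.val = j.val + 1)
    (h : u j < u k) :
    Disjoint (interior (polygon θ u)) (interior ((swapTile θ u j k h).carrier θ)) := by
  refine disjoint_interior_of_re_le fun z hz z' hz' him => ?_
  obtain ⟨-, -, r, hr, -, hrz, -, hzr⟩ := mem_polygon.1 hz
  obtain ⟨l, hl, hlz, hlz'⟩ := exists_path_left_of_mem_swapTile hθ hjk h hz'
  rw [eq_of_mem_path hθ hr hl (by rw [hrz, him, hlz])] at hzr
  exact hzr.trans hlz'

end AdjacentSwap


/-! ### Tilings from sorting by adjacent transpositions. -/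

section Tilings

variable {n : ℕ} {θ : Fin n → ℝ} {u : Equiv.Perm (Fin n)} {T : Finset (Tile n)}

/-- `T` tiles the region between the left boundary and the path of `u`, up to the sides in which
both paths agree. -/
structure IsPartialTiling (θ : Fin n → ℝ) (u : Equiv.Perm (Fin n)) (T : Finset (Tile n)) :
    Prop where
  iUnion_union : (⋃ t ∈ T, t.carrier θ) ∪ path θ 1 = polygon θ u
  pairwise : (T : Set (Tile n)).Pairwise fun s t =>
    Disjoint (interior (s.carrier θ)) (interior (t.carrier θ))
  covered_or_fixed : ∀ k, leftSide θ k ⊆ (⋃ t ∈ T, t.carrier θ) ∨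
    ((∀ i, (u i).val < k.val ↔ i.val < k.val) ∧ u k = k)
  exists_left : ∀ r ∈ path θ u, ∃ l ∈ path θ 1, l.im = r.im ∧ l.re ≤ r.re

/-- Here the region degenerates to the left boundary itself, which no tile covers; this is why `path
θ 1` is added to the union of the tiles. -/
theorem isPartialTiling_one (hθ : Admissible θ) : IsPartialTiling θ 1 ∅ where
  iUnion_union := by
    ext z
    simp only [Finset.notMem_empty, iUnion_of_empty, iUnion_empty, empty_union, mem_polygon]
    refine ⟨fun h => ⟨z, h, z, h, rfl, rfl, le_rfl, le_rfl⟩, ?_⟩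
    rintro ⟨l, hl, r, hr, hlz, hrz, hl', hr'⟩
    have := eq_of_mem_path hθ hl hr (hlz.trans hrz.symm)
    subst this
    rwa [show z = l from Complex.ext (le_antisymm hr' hl') hlz.symm]
  pairwise := by simp
  covered_or_fixed := by simp
  exists_left r hr := ⟨r, hr, rfl, le_rfl⟩

theorem IsPartialTiling.carrier_subset (hT : IsPartialTiling θ u T) {t : Tile n} (ht : t ∈ T) :
    t.carrier θ ⊆ polygon θ u := by
  rw [← hT.iUnion_union]
  exact (subset_biUnion_of_mem (u := fun t : Tile n => t.carrier θ) ht).trans subset_union_left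

open Classical in
theorem IsPartialTiling.insert_swapTile (hθ : Admissible θ) (hT : IsPartialTiling θ u T)
    {j k : Fin n} (hjk : k.val = j.val + 1) (h : u j < u k) :
    IsPartialTiling θ (u * Equiv.swap j k) (insert (swapTile θ u j k h) T) where
  iUnion_union := by
    rw [Finset.set_biUnion_insert, union_assoc, hT.iUnion_union,
      polygon_mul_swap hθ hjk h hT.exists_left, union_comm]
  pairwise := by
    rw [Finset.coe_insert]
    refine hT.pairwise.insert fun t ht _ => ?_
    have := (disjoint_interior_polygon_swapTile hθ hjk h).mono_left
      (interior_mono (hT.carrier_subset ht))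
    exact ⟨this.symm, this⟩
  covered_or_fixed i := by
    rw [Finset.set_biUnion_insert]
    rcases hT.covered_or_fixed i with hi | ⟨hi, hi'⟩
    · exact Or.inl (hi.trans subset_union_right)
    -- A left side not known to be covered is still a side of the path of `u`. If the swap involves
    -- position `i`, that side is an edge of the new tile; otherwise it stays fixed.
    have hv : vertex θ u i.val = vertex θ 1 i.val := by
      have := vertex_mul_of_forall (θ := θ) (u := 1) u hi
      rwa [one_mul] at this
    have hs : leftSide θ i = pathSide θ u i := by
      rw [leftSide, pathSide_upper, pathSide_upper, hv, hi', Equiv.Perm.one_apply]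
    by_cases hij : i = j
    · subst hij
      refine Or.inl (subset_union_of_subset_left ?_ _)
      rw [hs, pathSide_upper]
      exact segment_subset_rhombus_fst
    by_cases hik : i = k
    · subst hik
      refine Or.inl (subset_union_of_subset_left ?_ _)
      rw [hs, pathSide_lower _ hjk]
      exact segment_subset_rhombus_fst_snd
    refine Or.inr ⟨fun l => ?_, ?_⟩
    · rw [Equiv.Perm.mul_apply, hi, swap_val_lt_iff hjk (fun e => hik (Fin.ext (e.trans hjk.symm)))]
    · rw [Equiv.Perm.mul_apply, Equiv.swap_apply_of_ne_of_ne hij hik, hi']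
  exists_left r hr := by
    obtain ⟨m, hm, hmr, hmr'⟩ := exists_path_left_of_mem_path_mul_swap hθ hjk h hr
    obtain ⟨l, hl, hlm, hlm'⟩ := hT.exists_left m hm
    exact ⟨l, hl, hlm.trans hmr, hlm'.trans hmr'⟩

open Classical in
theorem IsPartialTiling.insert_of_descent (hθ : Admissible θ) {j k : Fin n}
    (hT : IsPartialTiling θ (u * Equiv.swap j k) T) (hjk : k.val = j.val + 1) (h : u k < u j) :
    IsPartialTiling θ u (insert ⟨vertex θ u j.val, u k, u j, h⟩ T) := by
  have := hT.insert_swapTile hθ hjk (by simpa using h)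
  simpa [mul_assoc, swapTile, vertex_mul_swap hjk] using this

theorem perm_eq_one_of_forall_lt (h : ∀ j k : Fin n, k.val = j.val + 1 → u j < u k) : u = 1 := by
  cases n with
  | zero => exact Subsingleton.elim _ _
  | succ n =>
    have hu : StrictMono u := Fin.strictMono_iff_lt_succ.2 fun i => h _ _ (by simp)
    have := Subsingleton.elim (hu.orderIsoOfSurjective _ u.surjective) (OrderIso.refl _)
    ext i
    exact congrArg Fin.val (DFunLike.congr_fun this i)

/-- Sorting terminates because undoing a descent lowers the word of the permutation
lexicographically. -/
theorem toLex_mul_swap_lt {j k : Fin n} (hjk : k.val = j.val + 1) (h : u k < u j) :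
    toLex (⇑(u * Equiv.swap j k)) < toLex (⇑u) := by
  refine ⟨j, fun i hi => ?_, by simpa using h⟩
  have : i ≠ k := fun e => by subst e; have : i.val < j.val := hi; omega
  simp [Equiv.swap_apply_of_ne_of_ne hi.ne this]

theorem exists_isPartialTiling (hθ : Admissible θ) (u : Equiv.Perm (Fin n)) :
    ∃ T, IsPartialTiling θ u T := by
  classical
  generalize hx : toLex (⇑u) = x
  induction x using (Finite.to_wellFoundedLT (α := Lex (Fin n → Fin n))).induction generalizing u with
  | ind x ih =>
    subst hx
    by_cases hu : ∀ j k : Fin n, k.val = j.val + 1 → u j < u k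
    · rw [perm_eq_one_of_forall_lt hu]
      exact ⟨∅, isPartialTiling_one hθ⟩
    push Not at hu
    obtain ⟨j, k, hjk, h⟩ := hu
    have h := h.lt_of_ne (u.injective.ne (fun e => by subst e; omega))
    obtain ⟨T, hT⟩ := ih _ (toLex_mul_swap_lt hjk h) _ rfl
    exact ⟨_, hT.insert_of_descent hθ hjk h⟩

theorem FullySupported.not_forall_lt_iff (hu : FullySupported u) {r : ℕ} (hr : 0 < r)
    (hrn : r < n) : ¬ ∀ i, (u i).val < r ↔ i.val < r := by
  intro h
  refine hu r hr hrn ?_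
  ext i
  rw [mem_image_equiv, mem_ofPred_eq, mem_ofPred_eq, ← h, Equiv.apply_symm_apply]

theorem FullySupported.apply_first_ne (hn : 2 ≤ n) (hu : FullySupported u) {e : Fin n}
    (he : e.val = 0) : u e ≠ e := by
  refine fun h => hu.not_forall_lt_iff one_pos hn fun i => ?_
  have h1 : u i = e ↔ i = e := by
    rw [← u.apply_eq_iff_eq (x := i), h]
  simp only [Fin.ext_iff] at h1
  omega

theorem FullySupported.apply_last_ne (hn : 2 ≤ n) (hu : FullySupported u) {e : Fin n}
    (he : e.val + 1 = n) : u e ≠ e := by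
  refine fun h => hu.not_forall_lt_iff (r := e.val) (by omega) e.isLt fun i => ?_
  have h1 : u i = e ↔ i = e := by
    rw [← u.apply_eq_iff_eq (x := i), h]
  simp only [Fin.ext_iff] at h1
  omega

/-- A left side shared with the path of `u` would give a proper initial segment preserved by `u`,
or, for the first side, a fixed first label. Full support excludes both, so the tiles alone cover
the left boundary. -/
theorem IsPartialTiling.isRhombicTiling (hn : 2 ≤ n) (hu : FullySupported u)
    (hT : IsPartialTiling θ u T) : IsRhombicTiling θ u T := by
  refine ⟨?_, hT.pairwise⟩
  rw [← hT.iUnion_union, eq_comm, union_eq_left]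
  refine iUnion_subset fun k => (hT.covered_or_fixed k).resolve_right ?_
  rintro ⟨h, hk⟩
  rcases Nat.eq_zero_or_pos k.val with h0 | h0
  · exact hu.apply_first_ne hn h0 hk
  · exact hu.not_forall_lt_iff h0 k.isLt h

/-- The tile spanned by the two sides in the top vertex. -/
theorem exists_isPartialTiling_top (hθ : Admissible θ) (hn : 0 < n) (u : Equiv.Perm (Fin n))
    (hu : (⟨0, hn⟩ : Fin n) < u ⟨0, hn⟩) :
    ∃ T, IsPartialTiling θ u T ∧ (⟨0, ⟨0, hn⟩, u ⟨0, hn⟩, hu⟩ : Tile n) ∈ T := by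
  classical
  -- The induction is on the position of the smallest label, which forms a descent with whatever
  -- precedes it and so can always be moved one place forward.
  obtain ⟨m, hm⟩ : ∃ m, (u.symm ⟨0, hn⟩).val = m := ⟨_, rfl⟩
  induction m generalizing u with
  | zero =>
    have : u.symm ⟨0, hn⟩ = ⟨0, hn⟩ := Fin.ext hm
    rw [Equiv.symm_apply_eq] at this
    exact absurd this hu.ne
  | succ m ih =>
    set k := u.symm ⟨0, hn⟩ with hk
    have huk : u k = ⟨0, hn⟩ := u.apply_symm_apply _
    have hml : m < n := by have := k.isLt; omega
    have hkm : k.val = (⟨m, hml⟩ : Fin n).val + 1 := hm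
    have hne : (⟨m, hml⟩ : Fin n) ≠ k := fun e => by rw [← e] at hm; simp at hm
    have hlt : u k < u ⟨m, hml⟩ := by
      have h1 := u.injective.ne hne
      rw [huk] at h1 ⊢
      exact Fin.lt_def.2 (Nat.pos_of_ne_zero fun e => h1 (Fin.ext e))
    rcases Nat.eq_zero_or_pos m with rfl | hm0
    -- From position 1, the swap to the front produces the wanted tile; the remaining region may be
    -- tiled arbitrarily.
    · obtain ⟨T, hT⟩ := exists_isPartialTiling hθ (u * Equiv.swap ⟨0, hn⟩ k)
      refine ⟨_, hT.insert_of_descent hθ hkm hlt, Finset.mem_insert.2 (Or.inl ?_)⟩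
      simp [huk, vertex_zero]
    · have h0 : (u * Equiv.swap ⟨m, hml⟩ k) ⟨0, hn⟩ = u ⟨0, hn⟩ := by
        rw [Equiv.Perm.mul_apply, Equiv.swap_apply_of_ne_of_ne] <;>
          simp only [ne_eq, Fin.ext_iff] <;> omega
      obtain ⟨T, hT, ht⟩ := ih (u * Equiv.swap ⟨m, hml⟩ k) (h0 ▸ hu) (by
        rw [show (u * Equiv.swap ⟨m, hml⟩ k).symm ⟨0, hn⟩ = ⟨m, hml⟩ by
          rw [Equiv.symm_apply_eq]; simp [huk]])
      refine ⟨_, hT.insert_of_descent hθ hkm hlt, Finset.mem_insert.2 (Or.inr ?_)⟩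
      simpa only [h0] using ht

/-- The tile spanned by the two sides in the bottom vertex. -/
theorem exists_isPartialTiling_bottom (hθ : Admissible θ) (u : Equiv.Perm (Fin n)) (e : Fin n)
    (he : e.val + 1 = n) (hu : u e < e) :
    ∃ T, IsPartialTiling θ u T ∧
      (⟨∑ i, edgeVec θ i - edgeVec θ (u e) - edgeVec θ e, u e, e, hu⟩ : Tile n) ∈ T := by
  classical
  -- Mirror argument: the largest label forms a descent with its successor, and `m` counts the
  -- places it still has to move back.
  obtain ⟨m, hm⟩ : ∃ m, (u.symm e).val + m = e.val :=
    ⟨_, Nat.add_sub_cancel' (by have := (u.symm e).isLt; omega)⟩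
  induction m generalizing u with
  | zero =>
    have : u.symm e = e := Fin.ext hm
    rw [Equiv.symm_apply_eq] at this
    exact absurd this.symm hu.ne
  | succ m ih =>
    set j := u.symm e with hj
    have huj : u j = e := u.apply_symm_apply _
    have hjl : j.val + 1 < n := by omega
    obtain ⟨k, hk⟩ : ∃ k : Fin n, k.val = j.val + 1 := ⟨⟨_, hjl⟩, rfl⟩
    have hne : k ≠ j := fun h => by rw [h] at hk; omega
    have hlt : u k < u j := by
      have h1 := u.injective.ne hne
      have h2 := (u k).isLt
      rw [huj] at h1 ⊢
      exact Fin.lt_def.2 (by have := Fin.val_ne_of_ne h1; omega)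
    rcases Nat.eq_zero_or_pos m with rfl | hm0
    · obtain ⟨T, hT⟩ := exists_isPartialTiling hθ (u * Equiv.swap j k)
      refine ⟨_, hT.insert_of_descent hθ hk hlt, Finset.mem_insert.2 (Or.inl ?_)⟩
      have hke : k = e := Fin.ext (by omega)
      have h3 : vertex θ u j.val + edgeVec θ (u j) + edgeVec θ (u k) = ∑ i, edgeVec θ i := by
        rw [← vertex_eq_sum θ u, ← vertex_succ, ← hk, ← vertex_succ, hke, he]
      rw [huj, hke] at h3
      simp only [hke, huj, Tile.mk.injEq, and_self, and_true]
      rw [← h3]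
      ring
    · have h0 : (u * Equiv.swap j k) e = u e := by
        rw [Equiv.Perm.mul_apply, Equiv.swap_apply_of_ne_of_ne] <;>
          simp only [ne_eq, Fin.ext_iff] <;> omega
      obtain ⟨T, hT, ht⟩ := ih (u * Equiv.swap j k) (h0 ▸ hu) (by
        rw [show (u * Equiv.swap j k).symm e = k by
          rw [Equiv.symm_apply_eq]; simp [huj]]
        omega)
      refine ⟨_, hT.insert_of_descent hθ hk hlt, Finset.mem_insert.2 (Or.inr ?_)⟩
      simpa only [h0] using ht

end Tilings


/-! ### Tiles at the top and bottom vertices. -/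

section Corners

variable {n : ℕ} {θ : Fin n → ℝ} {w : Equiv.Perm (Fin n)} {T : Finset (Tile n)}

theorem IsRhombicTiling.carrier_subset (hT : IsRhombicTiling θ w T) {t : Tile n} (ht : t ∈ T) :
    t.carrier θ ⊆ polygon θ w :=
  hT.1 ▸ subset_biUnion_of_mem (u := fun t : Tile n => t.carrier θ) ht

theorem IsRhombicTiling.eq_of_mem_interior (hT : IsRhombicTiling θ w T) {s t : Tile n}
    (hs : s ∈ T) (ht : t ∈ T) {z : ℂ} (hzs : z ∈ interior (s.carrier θ))
    (hzt : z ∈ interior (t.carrier θ)) : s = t := by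
  by_contra h
  exact Set.disjoint_left.1 (hT.2 hs ht h) hzs hzt

/-- The cone of a tile meets the cone spanned by labels on either side of it. -/
theorem exists_smul_add_eq_combination (hθ : Admissible θ) {p lo hi q : Fin n} (hp : p ≤ lo)
    (h : lo < hi) (hq : hi ≤ q) : ∃ s ∈ Ioo (0 : ℝ) 1, ∃ a ∈ Ioo (0 : ℝ) 1, ∃ b ∈ Ioo (0 : ℝ) 1,
      (s : ℂ) * edgeVec θ lo + (s : ℂ) * edgeVec θ hi
        = (a : ℂ) * edgeVec θ p + (b : ℂ) * edgeVec θ q := by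
  have hpq := cross_edgeVec_pos hθ (hp.trans_lt (h.trans_le hq))
  set d := edgeVec θ lo + edgeVec θ hi with hd
  have hA : 0 < cross d (edgeVec θ q) := by
    have h1 := cross_edgeVec_pos hθ (h.trans_le hq)
    have h2 := cross_edgeVec_nonneg hθ hq
    simp only [cross, hd, Complex.add_re, Complex.add_im] at h1 h2 ⊢
    linarith
  have hB : 0 < cross (edgeVec θ p) d := by
    have h1 := cross_edgeVec_pos hθ (hp.trans_lt h)
    have h2 := cross_edgeVec_nonneg hθ hp
    simp only [cross, hd, Complex.add_re, Complex.add_im] at h1 h2 ⊢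
    linarith
  have key := eq_combination_of_cross_ne_zero hpq.ne' d
  have hA := div_pos hA hpq
  have hB := div_pos hB hpq
  set A := cross d (edgeVec θ q) / cross (edgeVec θ p) (edgeVec θ q)
  set B := cross (edgeVec θ p) d / cross (edgeVec θ p) (edgeVec θ q)
  -- This scale brings all three coefficients below 1, hence the point into the interior of both
  -- rhombi.
  have hs : 0 < (1 + A + B)⁻¹ := by positivity
  refine ⟨(1 + A + B)⁻¹, ⟨hs, inv_lt_one_of_one_lt₀ (by linarith)⟩,
    (1 + A + B)⁻¹ * A, ⟨mul_pos hs hA, ?_⟩, (1 + A + B)⁻¹ * B, ⟨mul_pos hs hB, ?_⟩, ?_⟩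
  · rw [inv_mul_lt_iff₀ (by positivity)]; linarith
  · rw [inv_mul_lt_iff₀ (by positivity)]; linarith
  · rw [← mul_add, ← hd, key]
    push_cast
    ring

/-- Used to take a piece of an edge at a corner so short that its height is within the range of the
adjacent side of the right boundary. -/
theorem exists_mul_gt {x y : ℝ} (hx : x < 0) (hy : y < 0) : ∃ s ∈ Ioc (0 : ℝ) 1, y < s * x := by
  have hxy : x + y < 0 := by linarith
  refine ⟨y / (x + y), ⟨div_pos_of_neg_of_neg hy hxy, ?_⟩, ?_⟩
  · rw [div_le_one_of_neg hxy]; linarith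
  · rw [div_mul_eq_mul_div, lt_div_iff_of_neg hxy]; nlinarith

/-- Near the top, the right boundary is its first side, so a direction that stays in the polygon
cannot point to the right of that side. No analogue for the left boundary is needed, since it starts
with the smallest label. -/
theorem le_apply_of_mem_polygon_top (hθ : Admissible θ) {e i : Fin n} (he : e.val = 0)
    (hi : ∀ s ∈ Icc (0 : ℝ) 1, (s : ℂ) * edgeVec θ i ∈ polygon θ w) : i ≤ w e := by
  have h1 := edgeVec_im_neg hθ i
  have h2 := edgeVec_im_neg hθ (w e)
  obtain ⟨s, hs, hlt⟩ := exists_mul_gt h1 h2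
  obtain ⟨-, -, r, hr, -, hrz, -, hzr⟩ := mem_polygon.1 (hi s (Ioc_subset_Icc_self hs))
  obtain ⟨k, hk⟩ := mem_path.1 hr
  have hke : k = e := by
    by_contra hne
    have h3 := im_le_of_mem_pathSide hθ hk
    have h4 := vertex_im_antitone (u := w) hθ (show e.val + 1 ≤ k.val by
      have := Fin.val_ne_of_ne hne; omega)
    rw [vertex_succ, he, vertex_zero, zero_add] at h4
    rw [Complex.im_ofReal_mul] at hrz
    linarith
  subst hke
  obtain ⟨b, -, rfl⟩ := mem_pathSide.1 hk
  rw [he, vertex_zero, zero_add, Complex.im_ofReal_mul, Complex.im_ofReal_mul] at hrz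
  rw [he, vertex_zero, zero_add, Complex.re_ofReal_mul, Complex.re_ofReal_mul] at hzr
  refine le_of_cross_edgeVec_nonneg hθ (le_of_mul_le_mul_left ?_ hs.1)
  calc s * 0 ≤ (edgeVec θ (w k)).im * (s * (edgeVec θ i).re - b * (edgeVec θ (w k)).re) := by
        rw [mul_zero]; exact mul_nonneg_of_nonpos_of_nonpos h2.le (sub_nonpos.2 hzr)
    _ = _ := by
        simp only [cross]
        linear_combination -(edgeVec θ (w k)).re * hrz

theorem apply_le_of_mem_polygon_bottom (hθ : Admissible θ) {e i : Fin n} (he : e.val + 1 = n)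
    (hi : ∀ s ∈ Icc (0 : ℝ) 1, ∑ l, edgeVec θ l - (s : ℂ) * edgeVec θ i ∈ polygon θ w) :
    w e ≤ i := by
  have h1 := edgeVec_im_neg hθ i
  have h2 := edgeVec_im_neg hθ (w e)
  have hv : vertex θ w e.val = ∑ l, edgeVec θ l - edgeVec θ (w e) := by
    rw [eq_sub_iff_add_eq, ← vertex_succ, he, vertex_eq_sum]
  obtain ⟨s, hs, hlt⟩ := exists_mul_gt h1 h2
  obtain ⟨-, -, r, hr, -, hrz, -, hzr⟩ := mem_polygon.1 (hi s (Ioc_subset_Icc_self hs))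
  obtain ⟨k, hk⟩ := mem_path.1 hr
  have hke : k = e := by
    by_contra hne
    have h3 := le_im_of_mem_pathSide hθ hk
    have h4 := vertex_im_antitone (u := w) hθ (show k.val + 1 ≤ e.val by
      have := Fin.val_ne_of_ne hne; omega)
    rw [hv, Complex.sub_im] at h4
    rw [Complex.sub_im, Complex.im_ofReal_mul] at hrz
    linarith
  subst hke
  obtain ⟨b, -, rfl⟩ := mem_pathSide.1 hk
  simp only [hv, Complex.add_im, Complex.sub_im, Complex.im_ofReal_mul] at hrz
  simp only [hv, Complex.add_re, Complex.sub_re, Complex.re_ofReal_mul] at hzr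
  refine le_of_cross_edgeVec_nonneg hθ (le_of_mul_le_mul_left ?_ hs.1)
  have h3 : s * (edgeVec θ i).im = (1 - b) * (edgeVec θ (w k)).im := by linarith
  have h4 : (1 - b) * (edgeVec θ (w k)).re ≤ s * (edgeVec θ i).re := by linarith
  calc s * 0 ≤ (edgeVec θ (w k)).im * ((1 - b) * (edgeVec θ (w k)).re - s * (edgeVec θ i).re) := by
        rw [mul_zero]; exact mul_nonneg_of_nonpos_of_nonpos h2.le (sub_nonpos.2 h4)
    _ = _ := by
        simp only [cross]
        linear_combination -(edgeVec θ (w k)).re * h3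

theorem first_le {e : Fin n} (he : e.val = 0) (i : Fin n) : e ≤ i :=
  Fin.le_def.2 (by omega)

theorem le_last {e : Fin n} (he : e.val + 1 = n) (i : Fin n) : i ≤ e :=
  Fin.le_def.2 (by have := i.isLt; omega)

theorem IsRhombicTiling.eq_top_tile (hθ : Admissible θ) (hT : IsRhombicTiling θ w T) {e : Fin n}
    (he : e.val = 0) (hw : e < w e) (h0 : (⟨0, e, w e, hw⟩ : Tile n) ∈ T) {t : Tile n}
    (ht : t ∈ T) (htop : t.top = 0) : t = ⟨0, e, w e, hw⟩ := by
  have hhi : t.hi ≤ w e := le_apply_of_mem_polygon_top hθ he fun s hs =>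
    hT.carrier_subset ht ⟨0, by simp, s, hs, by simp [htop]⟩
  obtain ⟨s, hs, a, ha, b, hb, h⟩ := exists_smul_add_eq_combination hθ
    (first_le he t.lo) t.lo_lt_hi hhi
  refine hT.eq_of_mem_interior ht h0
    (mem_interior_rhombus (cross_edgeVec_pos hθ t.lo_lt_hi).ne' hs hs) ?_
  rw [htop, zero_add, h, ← zero_add ((a : ℂ) * edgeVec θ e)]
  exact mem_interior_rhombus (cross_edgeVec_pos hθ hw).ne' ha hb

theorem IsRhombicTiling.eq_bottom_tile (hθ : Admissible θ) (hT : IsRhombicTiling θ w T) {e : Fin n}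
    (he : e.val + 1 = n) (hw : w e < e)
    (h0 : (⟨∑ i, edgeVec θ i - edgeVec θ (w e) - edgeVec θ e, w e, e, hw⟩ : Tile n) ∈ T)
    {t : Tile n} (ht : t ∈ T)
    (hbot : t.top + edgeVec θ t.lo + edgeVec θ t.hi = ∑ i, edgeVec θ i) :
    t = ⟨∑ i, edgeVec θ i - edgeVec θ (w e) - edgeVec θ e, w e, e, hw⟩ := by
  have hlo : w e ≤ t.lo := apply_le_of_mem_polygon_bottom hθ he fun s hs =>
    hT.carrier_subset ht ⟨1 - s, by simpa [and_comm] using hs, 1, by simp, by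
      rw [← hbot]; push_cast; ring⟩
  obtain ⟨s, hs, a, ha, b, hb, h⟩ := exists_smul_add_eq_combination hθ hlo t.lo_lt_hi
    (le_last he t.hi)
  -- Coefficients are now measured upwards from the bottom vertex, which replaces `x` by `1 - x` in
  -- the coordinates of a rhombus.
  have symm : ∀ {x : ℝ}, x ∈ Ioo (0 : ℝ) 1 → 1 - x ∈ Ioo (0 : ℝ) 1 := fun hx =>
    ⟨sub_pos.2 hx.2, sub_lt_self 1 hx.1⟩
  refine hT.eq_of_mem_interior ht h0
    (mem_interior_rhombus (cross_edgeVec_pos hθ t.lo_lt_hi).ne' (symm hs) (symm hs)) ?_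
  refine (congrArg (· ∈ interior _) ?_).mpr (mem_interior_rhombus
    (p := ∑ i, edgeVec θ i - edgeVec θ (w e) - edgeVec θ e)
    (cross_edgeVec_pos hθ hw).ne' (symm ha) (symm hb))
  rw [← hbot]
  push_cast
  linear_combination -h

/-- The highest and lowest points of a descending segment are its endpoints. This allows the label
of a side to be read off from the side as a point set. -/
theorem segment_add_inj {p q a b : ℂ} (ha : a.im < 0) (hb : b.im < 0)
    (h : segment ℝ p (p + a) = segment ℝ q (q + b)) : p = q ∧ a = b := by
  obtain ⟨s, hs, hps⟩ := mem_segment_add.1 (h ▸ left_mem_segment ℝ p (p + a))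
  obtain ⟨t, ht, hqt⟩ := mem_segment_add.1 (h ▸ left_mem_segment ℝ q (q + b))
  have hpq : p = q := by
    have h1 := congrArg Complex.im hps
    have h2 := congrArg Complex.im hqt
    simp only [Complex.add_im, Complex.im_ofReal_mul] at h1 h2
    have h3 := mul_nonpos_of_nonneg_of_nonpos ht.1 ha.le
    have h4 := mul_nonpos_of_nonneg_of_nonpos hs.1 hb.le
    have h5 : s = 0 := (mul_eq_zero.1 (show s * b.im = 0 by linarith)).resolve_right hb.ne
    simpa [h5] using hps
  subst hpq
  obtain ⟨s, hs, hps⟩ := mem_segment_add.1 (h ▸ right_mem_segment ℝ p (p + a))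
  obtain ⟨t, ht, hqt⟩ := mem_segment_add.1 (h ▸ right_mem_segment ℝ p (p + b))
  rw [add_right_inj] at hps hqt
  have h1 := congrArg Complex.im hps
  have h2 := congrArg Complex.im hqt
  rw [Complex.im_ofReal_mul] at h1 h2
  have h3 : s = 1 := by nlinarith [hs.2, ht.2]
  exact ⟨rfl, by simpa [h3] using hps⟩

theorem Tile.subset_carrier_of_mem_edges {t : Tile n} {E : Set ℂ} (hE : E ∈ t.edges θ) :
    E ⊆ t.carrier θ := by
  rcases hE with rfl | rfl | rfl | rfl
  · exact segment_subset_rhombus_fst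
  · exact segment_subset_rhombus_snd
  · exact segment_subset_rhombus_fst_snd
  · exact segment_subset_rhombus_snd_fst

theorem Tile.apply_mem_labels_of_pathSide_mem_edges (hθ : Admissible θ) {t : Tile n} {k : Fin n}
    (h : pathSide θ w k ∈ t.edges θ) : w k ∈ t.labels := by
  have key : ∀ p i, pathSide θ w k = segment ℝ p (p + edgeVec θ i) → w k = i := by
    intro p i h
    rw [pathSide_upper] at h
    exact edgeVec_injective hθ
      (segment_add_inj (edgeVec_im_neg hθ _) (edgeVec_im_neg hθ _) h).2
  rw [Tile.labels, Finset.mem_insert, Finset.mem_singleton]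
  rcases h with h | h | h | h
  · exact Or.inl (key _ _ h)
  · exact Or.inr (key _ _ h)
  · exact Or.inr (key _ _ h)
  · rw [add_right_comm] at h
    exact Or.inl (key _ _ h)

/-- The origin is at the maximal height of the polygon, and a tile attains its maximal height only
in its top. -/
theorem Tile.top_eq_zero (hθ : Admissible θ) {t : Tile n} (ht : t.carrier θ ⊆ polygon θ w)
    (h0 : 0 ∈ t.carrier θ) : t.top = 0 := by
  have h1 : t.top.im ≤ 0 := by
    obtain ⟨l, hl, -, -, hlz, -⟩ := mem_polygon.1 (ht ⟨0, by simp, 0, by simp, by simp⟩ :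
      t.top ∈ polygon θ w)
    obtain ⟨k, hk⟩ := mem_path.1 hl
    have h2 := im_le_of_mem_pathSide hθ hk
    have h3 := vertex_im_antitone (u := 1) hθ (Nat.zero_le k.val)
    rw [vertex_zero, Complex.zero_im] at h3
    linarith
  obtain ⟨a, ha, b, hb, h⟩ := h0
  have hlo := edgeVec_im_neg hθ t.lo
  have hhi := edgeVec_im_neg hθ t.hi
  have h2 := congrArg Complex.im h
  simp only [Complex.add_im, Complex.im_ofReal_mul, Complex.zero_im] at h2
  have h3 := mul_nonpos_of_nonneg_of_nonpos ha.1 hlo.le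
  have h4 := mul_nonpos_of_nonneg_of_nonpos hb.1 hhi.le
  have h5 : a = 0 := (mul_eq_zero.1 (show a * _ = 0 by linarith)).resolve_right hlo.ne
  have h6 : b = 0 := (mul_eq_zero.1 (show b * _ = 0 by linarith)).resolve_right hhi.ne
  simpa [h5, h6, eq_comm] using h

theorem Tile.bottom_eq_sum (hθ : Admissible θ) {t : Tile n} (ht : t.carrier θ ⊆ polygon θ w)
    (h0 : ∑ i, edgeVec θ i ∈ t.carrier θ) :
    t.top + edgeVec θ t.lo + edgeVec θ t.hi = ∑ i, edgeVec θ i := by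
  have h1 : (∑ i, edgeVec θ i).im ≤ (t.top + edgeVec θ t.lo + edgeVec θ t.hi).im := by
    obtain ⟨l, hl, -, -, hlz, -⟩ := mem_polygon.1 (ht ⟨1, by simp, 1, by simp, by simp⟩ :
      t.top + edgeVec θ t.lo + edgeVec θ t.hi ∈ polygon θ w)
    obtain ⟨k, hk⟩ := mem_path.1 hl
    have h2 := le_im_of_mem_pathSide hθ hk
    have h3 := vertex_im_antitone (u := 1) hθ (Nat.succ_le_of_lt k.isLt)
    rw [vertex_eq_sum, Nat.succ_eq_add_one] at h3
    linarith
  obtain ⟨a, ha, b, hb, h⟩ := h0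
  have hlo := edgeVec_im_neg hθ t.lo
  have hhi := edgeVec_im_neg hθ t.hi
  have h2 := congrArg Complex.im h
  simp only [Complex.add_im, Complex.im_ofReal_mul] at h1 h2
  have h3 := mul_nonpos_of_nonneg_of_nonpos (sub_nonneg.2 ha.2) hlo.le
  have h4 := mul_nonpos_of_nonneg_of_nonpos (sub_nonneg.2 hb.2) hhi.le
  have h5 : 1 - a = 0 := (mul_eq_zero.1 (show (1 - a) * _ = 0 by linarith)).resolve_right hlo.ne
  have h6 : 1 - b = 0 := (mul_eq_zero.1 (show (1 - b) * _ = 0 by linarith)).resolve_right hhi.ne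
  rw [h, ← sub_eq_zero.1 h5, ← sub_eq_zero.1 h6]
  simp

theorem isForcedTop_of_zero_mem (hn : 2 ≤ n) (hw : FullySupported w) (hθ : Admissible θ)
    {t : Tile n} (ht : ∀ T, IsRhombicTiling θ w T → t ∈ T ∧ 0 ∈ t.carrier θ) :
    IsForcedTop θ w t := by
  have hn0 : 0 < n := by omega
  have hlt : (⟨0, hn0⟩ : Fin n) < w ⟨0, hn0⟩ :=
    (first_le rfl _).lt_of_ne (hw.apply_first_ne hn rfl).symm
  obtain ⟨T, hT, h0⟩ := exists_isPartialTiling_top hθ hn0 w hlt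
  have hT := hT.isRhombicTiling hn hw
  obtain ⟨htT, htc⟩ := ht T hT
  -- The special tiling identifies `t` once and for all; for the other tilings only membership of
  -- `t` is needed.
  have := hT.eq_top_tile hθ rfl hlt h0 htT (t.top_eq_zero hθ (hT.carrier_subset htT) htc)
  refine fun T' hT' => ⟨(ht T' hT').1, ⟨0, hn0⟩, rfl, ?_, ?_⟩
  · rw [this, leftSide, pathSide_upper, vertex_zero]
    exact Or.inl rfl
  · rw [this, rightSide, pathSide_upper, vertex_zero]
    exact Or.inr (Or.inl rfl)

theorem isForcedBottom_of_sum_mem (hn : 2 ≤ n) (hw : FullySupported w) (hθ : Admissible θ)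
    {t : Tile n} (ht : ∀ T, IsRhombicTiling θ w T → t ∈ T ∧ ∑ i, edgeVec θ i ∈ t.carrier θ) :
    IsForcedBottom θ w t := by
  obtain ⟨e, he⟩ : ∃ e : Fin n, e.val + 1 = n := ⟨⟨n - 1, by omega⟩, by simp only; omega⟩
  have hlt : w e < e := (le_last he _).lt_of_ne (hw.apply_last_ne hn he)
  obtain ⟨T, hT, h0⟩ := exists_isPartialTiling_bottom hθ w e he hlt
  have hT := hT.isRhombicTiling hn hw
  obtain ⟨htT, htc⟩ := ht T hT
  have := hT.eq_bottom_tile hθ he hlt h0 htT (t.bottom_eq_sum hθ (hT.carrier_subset htT) htc)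
  have hv : ∀ u : Equiv.Perm (Fin n), pathSide θ u e =
      segment ℝ (∑ i, edgeVec θ i - edgeVec θ (u e)) (∑ i, edgeVec θ i) := by
    intro u
    have h1 := vertex_succ θ u e
    rw [he, vertex_eq_sum] at h1
    rw [pathSide_upper, ← h1, h1, add_sub_cancel_right]
  refine fun T' hT' => ⟨(ht T' hT').1, e, he, ?_, ?_⟩
  · rw [this, leftSide, hv]
    refine Or.inr (Or.inr (Or.inl ?_))
    simp only [Equiv.Perm.one_apply]
    congr 1 <;> ring
  · rw [this, rightSide, hv]
    refine Or.inr (Or.inr (Or.inr ?_))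
    simp only [Set.mem_singleton_iff]
    congr 1 <;> ring

/-- If two consecutive sides of a path with label sets `{u a, u b}`, `b = a + 1`, are edges of a
tile with these labels, then these are the sides number `a` and `b`. -/
theorem pathSide_subset_carrier (hθ : Admissible θ) {u : Equiv.Perm (Fin n)} {t : Tile n}
    {a b : Fin n} (hab : b.val = a.val + 1) (hl : t.labels = {u a, u b})
    (h : ∃ j k : Fin n, k.val = j.val + 1 ∧ pathSide θ u j ∈ t.edges θ ∧
      pathSide θ u k ∈ t.edges θ) :
    pathSide θ u a ⊆ t.carrier θ ∧ pathSide θ u b ⊆ t.carrier θ := by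
  obtain ⟨j, k, hjk, hj, hk⟩ := h
  have h1 := t.apply_mem_labels_of_pathSide_mem_edges hθ hj
  have h2 := t.apply_mem_labels_of_pathSide_mem_edges hθ hk
  simp only [hl, Finset.mem_insert, Finset.mem_singleton, u.apply_eq_iff_eq, Fin.ext_iff] at h1 h2
  -- The label condition places both `j` and `k` in `{a, b}`, and being consecutive leaves only one
  -- possibility.
  have hja : j = a := Fin.ext (by omega)
  have hkb : k = b := Fin.ext (by omega)
  subst hja hkb
  exact ⟨t.subset_carrier_of_mem_edges hj, t.subset_carrier_of_mem_edges hk⟩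

theorem zero_mem_pathSide (u : Equiv.Perm (Fin n)) {e : Fin n} (he : e.val = 0) :
    0 ∈ pathSide θ u e := by
  have := left_mem_pathSide (θ := θ) (u := u) e
  rwa [he, vertex_zero] at this

theorem sum_mem_pathSide (u : Equiv.Perm (Fin n)) {e : Fin n} (he : e.val + 1 = n) :
    ∑ i, edgeVec θ i ∈ pathSide θ u e := by
  have := right_mem_pathSide (θ := θ) (u := u) e
  rwa [he, vertex_eq_sum] at this

end Corners

end Elnitsky

theorem corollary4 (n : ℕ) (hn : 2 ≤ n) (w : Equiv.Perm (Fin n))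
    (hw : Elnitsky.FullySupported w) (θ : Fin n → ℝ) (hθ : Elnitsky.Admissible θ) :
    (∀ t : Elnitsky.Tile n, t.labels = {w ⟨0, by omega⟩, w ⟨1, by omega⟩} →
      Elnitsky.IsForcedRight θ w t → Elnitsky.IsForcedTop θ w t) ∧
    (∀ t : Elnitsky.Tile n, t.labels = {⟨0, by omega⟩, ⟨1, by omega⟩} →
      Elnitsky.IsForcedLeft θ w t → Elnitsky.IsForcedTop θ w t) ∧
    (∀ t : Elnitsky.Tile n, t.labels = {w ⟨n - 2, by omega⟩, w ⟨n - 1, by omega⟩} →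
      Elnitsky.IsForcedRight θ w t → Elnitsky.IsForcedBottom θ w t) ∧
    (∀ t : Elnitsky.Tile n, t.labels = {⟨n - 2, by omega⟩, ⟨n - 1, by omega⟩} →
      Elnitsky.IsForcedLeft θ w t → Elnitsky.IsForcedBottom θ w t) := by
  refine ⟨fun t hl ht => ?_, fun t hl ht => ?_, fun t hl ht => ?_, fun t hl ht => ?_⟩
  · exact Elnitsky.isForcedTop_of_zero_mem hn hw hθ fun T hT => ⟨(ht T hT).1,
      (Elnitsky.pathSide_subset_carrier hθ rfl hl (ht T hT).2).1
        (Elnitsky.zero_mem_pathSide w rfl)⟩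
  · exact Elnitsky.isForcedTop_of_zero_mem hn hw hθ fun T hT => ⟨(ht T hT).1,
      (Elnitsky.pathSide_subset_carrier (u := 1) hθ rfl hl (ht T hT).2).1
        (Elnitsky.zero_mem_pathSide 1 rfl)⟩
  · exact Elnitsky.isForcedBottom_of_sum_mem hn hw hθ fun T hT => ⟨(ht T hT).1,
      (Elnitsky.pathSide_subset_carrier hθ (by simp only; omega) hl (ht T hT).2).2
        (Elnitsky.sum_mem_pathSide w (by simp only; omega))⟩
  · exact Elnitsky.isForcedBottom_of_sum_mem hn hw hθ fun T hT => ⟨(ht T hT).1,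
      (Elnitsky.pathSide_subset_carrier (u := 1) hθ (by simp only; omega) hl (ht T hT).2).2
        (Elnitsky.sum_mem_pathSide 1 (by simp only; omega))⟩
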